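/- Call a (discrete) group $G$ amenable if there is a left-invariant mean on $\ell^\infty(G)$, and residually amenable if for every $g\in G\setminus\{e\}$ there are an amenable group $C$ and a surjective homomorphism $\varphi\colon G\to C$ with $\varphi(g)\neq e$. The proamenable topology of $G$ is the topology for which, at each $g\in G$, the cosets $gN$ form a basis of neighbourhoods, where $N$ runs over the normal subgroups of $G$ with $G/N$ amenable. Let $A$ be a group, let $H\leq A$ be a subgroup, and let $$A\ast_{\mathrm{id}}=\langle A,t\mid t^{-1}ht=h\ \ \forall h\in H\rangle$$ be the special HNN extension of $A$ amalgamating $H$. Then $A\ast_{\mathrm{id}}$ is residually amenable if and only if $A$ is residually amenable and $H$ is closed in the proamenable topology of $A$. -/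

import Mathlib

open scoped Topology

/-- The real vector space `ℓ^∞(G)` of all bounded functions `G → ℝ`. -/
def boundedFunctions (G : Type*) : Submodule ℝ (G → ℝ) where
  carrier := {f | ∃ c : ℝ, ∀ x, |f x| ≤ c}
  zero_mem' := ⟨0, fun x => by simp⟩
  add_mem' := by
    rintro f g ⟨c, hc⟩ ⟨d, hd⟩
    exact ⟨c + d, fun x => (abs_add_le (f x) (g x)).trans (add_le_add (hc x) (hd x))⟩
  smul_mem' := by
    rintro r f ⟨c, hc⟩
    refine ⟨|r| * c, fun x => ?_⟩
    simpa [abs_mul] using mul_le_mul_of_nonneg_left (hc x) (abs_nonneg r)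

/-- The constant function `1`, as an element of `ℓ^∞(G)`. -/
def boundedOne (G : Type*) : boundedFunctions G :=
  ⟨fun _ => 1, 1, fun _ => by simp⟩

/-- The translate `x ↦ f (g⁻¹ * x)` of `f ∈ ℓ^∞(G)` by `g : G`. -/
def leftTranslate {G : Type*} [Group G] (g : G) (f : boundedFunctions G) : boundedFunctions G :=
  ⟨fun x => f.1 (g⁻¹ * x), f.2.imp fun _ hc x => hc (g⁻¹ * x)⟩

/-- A (discrete) group `G` is amenable if there is a left-invariant mean on `ℓ^∞(G)`: a positive,
normalized linear functional that is invariant under left translations. -/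
def IsAmenableGroup (G : Type*) [Group G] : Prop :=
  ∃ m : boundedFunctions G →ₗ[ℝ] ℝ,
    (∀ f : boundedFunctions G, (∀ x, 0 ≤ f.1 x) → 0 ≤ m f) ∧
    m (boundedOne G) = 1 ∧
    ∀ (g : G) (f : boundedFunctions G), m (leftTranslate g f) = m f

universe u

/-- A group `G` is residually amenable if for every `g ≠ 1` there is a surjective homomorphism
from `G` onto an amenable group that does not kill `g`. (All images of `G` have isomorphic copies
in the universe of `G`.) -/
def IsResiduallyAmenable (G : Type u) [Group G] : Prop :=
  ∀ g : G, g ≠ 1 → ∃ (C : Type u) (_ : Group C) (φ : G →* C),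
    IsAmenableGroup C ∧ Function.Surjective φ ∧ φ g ≠ 1

/-- The proamenable topology of a group `G`: the topology generated by all the cosets `g N` of
normal subgroups `N` of `G` with amenable quotient `G ⧸ N`. The family of such `N` is closed under
finite intersections, so it is a basis at `1` of this topology. -/
abbrev proamenableTopology (G : Type*) [Group G] : TopologicalSpace G :=
  TopologicalSpace.generateFrom
    {U : Set G | ∃ (g : G) (N : Subgroup G) (_ : N.Normal),
      IsAmenableGroup (G ⧸ N) ∧ U = {x : G | g⁻¹ * x ∈ N}}

/-- The special HNN extension `⟨A, t ∣ t⁻¹ h t = h for all h ∈ H⟩` of a group `A` with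
amalgamated subgroup `H`. -/
abbrev SpecialHNNExtension (A : Type*) [Group A] (H : Subgroup A) : Type _ :=
  HNNExtension A H H (MulEquiv.refl H)

/-! Sending `t` to the trivial coset embeds the extension in `FreeGroup (A ⧸ H) ⋊ A`. If an element
has nontrivial image in `A`, residual amenability of `A` detects it. Otherwise it is a word `w ≠ 1`
on finitely many cosets, detected by some `f : A ⧸ H → P` with `P` finite. As `H` is closed, some
coamenable `N` keeps those cosets distinct in `(A ⧸ N) ⧸ (HN / N)`. Taking all maps from this set to
`P` at once gives an `A ⧸ N`-equivariant target: a power of `P`, which is locally finite, extended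
by `A ⧸ N`, hence amenable.

Conversely, `A` embeds in the extension, and for `a ∉ H` an amenable quotient detecting the
commutator of `a` and `t` separates `a` from `H`. -/

/-- The composition with a map `β : X → Y`, as a linear map `ℓ^∞(Y) → ℓ^∞(X)`. -/
def boundedFunctions.comap {X Y : Type*} (β : X → Y) :
    boundedFunctions Y →ₗ[ℝ] boundedFunctions X where
  toFun f := ⟨f.1 ∘ β, f.2.imp fun _ hc x => hc (β x)⟩
  map_add' _ _ := rfl
  map_smul' _ _ := rfl

/-! ### Permanence properties of amenability -/

namespace IsAmenableGroup

/-- Amenability passes along a map `β : C → B` that is equivariant over a map `i : B → C`. -/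
theorem of_equivariant {B C : Type*} [Group B] [Group C] (i : B → C) (β : C → B)
    (h : ∀ b c, β (i b * c) = b * β c) (hC : IsAmenableGroup C) : IsAmenableGroup B := by
  obtain ⟨m, hpos, hone, hinv⟩ := hC
  refine ⟨m ∘ₗ boundedFunctions.comap β, fun f hf => hpos _ fun x => hf _, hone, fun b f => ?_⟩
  rw [LinearMap.comp_apply, LinearMap.comp_apply, ← hinv (i b) (boundedFunctions.comap β f)]
  congr 1
  ext c
  have : β ((i b)⁻¹ * c) = b⁻¹ * β c := by
    rw [eq_inv_mul_iff_mul_eq, ← h, mul_inv_cancel_left]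
  simp [boundedFunctions.comap, leftTranslate, this]

/-- A transversal of the right cosets of `i.range` splits `c` as `i (β c) * r c`, and `β` is
equivariant. -/
theorem of_injective {B C : Type*} [Group B] [Group C] (i : B →* C) (hi : Function.Injective i)
    (hC : IsAmenableGroup C) : IsAmenableGroup B := by
  let r : C → C := fun c => (Quotient.mk (QuotientGroup.rightRel i.range) c).out
  have hr : ∀ c, ∃ b, i b = c * (r c)⁻¹ := fun c =>
    QuotientGroup.rightRel_apply.1 (Quotient.mk_out (s := QuotientGroup.rightRel i.range) c)
  have hr' : ∀ b c, r (i b * c) = r c := fun b c => by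
    have : Quotient.mk (QuotientGroup.rightRel i.range) (i b * c) = Quotient.mk _ c := by
      refine Quotient.sound (QuotientGroup.rightRel_apply.2 ?_)
      simp
    simp only [r, this]
  choose β hβ using hr
  refine of_equivariant i β (fun b c => hi ?_) hC
  rw [hβ, hr', map_mul, hβ, mul_assoc]

theorem abs_mean_le {G : Type*} {m : boundedFunctions G →ₗ[ℝ] ℝ}
    (hpos : ∀ f : boundedFunctions G, (∀ x, 0 ≤ f.1 x) → 0 ≤ m f) (hone : m (boundedOne G) = 1)
    {f : boundedFunctions G} {c : ℝ} (hf : ∀ x, |f.1 x| ≤ c) : |m f| ≤ c := by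
  rw [abs_le]
  constructor
  · have := hpos (c • boundedOne G + f) fun x => by
      have := (abs_le.1 (hf x)).1
      simp only [boundedOne, Submodule.coe_add, Submodule.coe_smul, Pi.add_apply, Pi.smul_apply,
        smul_eq_mul]
      linarith
    rw [map_add, map_smul, hone, smul_eq_mul] at this
    linarith
  · have := hpos (c • boundedOne G - f) fun x => by
      have := (abs_le.1 (hf x)).2
      simp only [boundedOne, Submodule.coe_sub, Submodule.coe_smul, Pi.sub_apply, Pi.smul_apply,
        smul_eq_mul]
      linarith
    rw [map_sub, map_smul, hone, smul_eq_mul] at this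
    linarith

/-- Average over each coset of `N`, then over `B`. -/
theorem semidirectProduct {N B : Type*} [Group N] [Group B] (φ : B →* MulAut N)
    (hN : IsAmenableGroup N) (hB : IsAmenableGroup B) : IsAmenableGroup (N ⋊[φ] B) := by
  obtain ⟨m, hpos, hone, hinv⟩ := hN
  obtain ⟨m', hpos', hone', hinv'⟩ := hB
  let s : B → N → N ⋊[φ] B := fun b n => .inr b * .inl n
  let T : boundedFunctions (N ⋊[φ] B) →ₗ[ℝ] boundedFunctions B :=
    { toFun f := ⟨fun b => m (boundedFunctions.comap (s b) f),
        f.2.imp fun c hc b => abs_mean_le hpos hone fun x => hc _⟩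
      map_add' f g := by ext b; simp
      map_smul' r f := by ext b; simp }
  refine ⟨m' ∘ₗ T, fun f hf => hpos' _ fun b => hpos _ fun n => hf _, ?_, fun g f => ?_⟩
  · rw [LinearMap.comp_apply, ← hone']
    congr 1
    ext b
    exact hone
  · have key : T (leftTranslate g f) = leftTranslate g.right (T f) := by
      ext b
      change m _ = m _
      -- Left translation by `g` permutes the cosets of `N` through `g.right`, up to the translation
      -- by `φ b⁻¹ g.left` inside the coset.
      rw [← hinv (φ b⁻¹ g.left) (boundedFunctions.comap (s (g.right⁻¹ * b)) f)]
      congr 1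
      ext n
      refine congrArg f.1 ?_
      ext <;> simp [s]
    rw [LinearMap.comp_apply, LinearMap.comp_apply, key, hinv']

theorem prod {B C : Type*} [Group B] [Group C] (hB : IsAmenableGroup B) (hC : IsAmenableGroup C) :
    IsAmenableGroup (B × C) :=
  of_injective (SemidirectProduct.mulEquivProd (N := B) (G := C)).symm.toMonoidHom
    (MulEquiv.injective _) (semidirectProduct 1 hB hC)

/-- Locally finite groups are amenable. -/
theorem of_locallyFinite {G : Type*} [Group G]
    (hG : ∀ S : Finset G, ∃ L : Subgroup G, Finite L ∧ (S : Set G) ⊆ L) : IsAmenableGroup G := by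
  classical
  choose L hL hSL using hG
  have := fun S => Fintype.ofFinite (L S)
  let avg : Finset G → boundedFunctions G →ₗ[ℝ] ℝ := fun S =>
    { toFun f := (Fintype.card (L S) : ℝ)⁻¹ * ∑ q : L S, f.1 q
      map_add' f g := by simp [Finset.sum_add_distrib, mul_add]
      map_smul' r f := by simp [← Finset.mul_sum, mul_left_comm] }
  have avg_pos : ∀ S f, (∀ x, 0 ≤ f.1 x) → 0 ≤ avg S f := fun S f hf =>
    mul_nonneg (by positivity) (Finset.sum_nonneg fun q _ => hf q)
  have avg_one : ∀ S, avg S (boundedOne G) = 1 := fun S => by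
    simp [avg, boundedOne]
  -- Bounded families converge along an ultrafilter, and one below `atTop` eventually has `g ∈ L S`.
  let U : Ultrafilter (Finset G) := Ultrafilter.of Filter.atTop
  have hlim : ∀ f, ∃ c, Filter.Tendsto (fun S => avg S f) U (𝓝 c) := fun f => by
    obtain ⟨c, hc⟩ := f.2
    obtain ⟨x, -, hx⟩ := (isCompact_Icc (a := -c) (b := c)).ultrafilter_le_nhds
      (U.map fun S => avg S f) (by
        rw [Filter.le_principal_iff]
        refine Filter.mem_map.2 (Filter.univ_mem' fun S => ?_)
        exact abs_le.1 (abs_mean_le (avg_pos S) (avg_one S) hc))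
    exact ⟨x, hx⟩
  choose M hM using hlim
  refine ⟨{ toFun := M, map_add' := fun f g => ?_, map_smul' := fun r f => ?_ },
    fun f hf => ?_, ?_, fun g f => ?_⟩
  · refine tendsto_nhds_unique (hM _) ?_
    simpa using (hM f).add (hM g)
  · refine tendsto_nhds_unique (hM _) ?_
    simpa using (hM f).const_mul r
  · exact ge_of_tendsto' (hM f) fun S => avg_pos S f hf
  · refine tendsto_nhds_unique (hM _) ?_
    simp [avg_one]
  · refine tendsto_nhds_unique ((hM f).congr' ?_) (hM (leftTranslate g f)) |>.symm
    filter_upwards [Ultrafilter.of_le _ (Filter.mem_atTop ({g} : Finset G))] with S hS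
    have hg : g ∈ L S := hSL S (by simpa using hS)
    refine congrArg (fun x : ℝ => (Fintype.card (L S) : ℝ)⁻¹ * x) ?_
    rw [← Equiv.sum_comp (Equiv.mulLeft (⟨g, hg⟩⁻¹ : L S))]
    rfl

/-- A power of a finite group is amenable, since it is locally finite. -/
theorem pi_const (ι P : Type*) [Group P] [Finite P] : IsAmenableGroup (ι → P) := by
  refine of_locallyFinite fun S => ?_
  -- `k i` records the values at `i` of all members of `S`; functions factoring through `k` form a
  -- finite subgroup containing `S`.
  let k : ι → (S → P) := fun i s => s.1 i
  let φ : ((S → P) → P) →* (ι → P) :=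
    { toFun F := F ∘ k, map_one' := rfl, map_mul' _ _ := rfl }
  exact ⟨φ.range, Set.finite_range φ, fun s hs => ⟨fun v => v ⟨s, hs⟩, rfl⟩⟩

theorem of_subsingleton (G : Type*) [Group G] [Subsingleton G] : IsAmenableGroup G :=
  of_injective (1 : G →* (Unit → Unit)) (Function.injective_of_subsingleton _) (pi_const _ _)

end IsAmenableGroup

/-! ### Coamenable subgroups and the proamenable topology -/

/-- A normal subgroup with amenable quotient. -/
def IsCoamenable {G : Type*} [Group G] (N : Subgroup G) : Prop :=
  ∃ _ : N.Normal, IsAmenableGroup (G ⧸ N)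

namespace IsCoamenable

variable {G : Type*} [Group G]

theorem ker {C : Type*} [Group C] (hC : IsAmenableGroup C) (φ : G →* C) :
    IsCoamenable φ.ker :=
  ⟨inferInstance, .of_injective (QuotientGroup.kerLift φ) (QuotientGroup.kerLift_injective φ) hC⟩

theorem top : IsCoamenable (⊤ : Subgroup G) :=
  have := QuotientGroup.subsingleton_quotient_top (G := G)
  ⟨inferInstance, .of_subsingleton _⟩

theorem inf {N M : Subgroup G} (hN : IsCoamenable N) (hM : IsCoamenable M) :
    IsCoamenable (N ⊓ M) := by
  obtain ⟨_, hN⟩ := hN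
  obtain ⟨_, hM⟩ := hM
  have := ker (hN.prod hM) ((QuotientGroup.mk' N).prod (QuotientGroup.mk' M))
  rwa [MonoidHom.ker_prod, QuotientGroup.ker_mk', QuotientGroup.ker_mk'] at this

end IsCoamenable

theorem exists_isCoamenable_of_isOpen {G : Type*} [Group G] {U : Set G}
    (hU : IsOpen[proamenableTopology G] U) {x : G} (hx : x ∈ U) :
    ∃ N : Subgroup G, IsCoamenable N ∧ ∀ n ∈ N, x * n ∈ U := by
  induction hU with
  | basic U h =>
    obtain ⟨g, N, hN, hA, rfl⟩ := h
    exact ⟨N, ⟨hN, hA⟩, fun n hn => by simpa [← mul_assoc] using N.mul_mem hx hn⟩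
  | univ => exact ⟨⊤, .top, fun _ _ => trivial⟩
  | inter s t _ _ hs ht =>
    obtain ⟨N, hN, hs⟩ := hs hx.1
    obtain ⟨M, hM, ht⟩ := ht hx.2
    exact ⟨N ⊓ M, hN.inf hM, fun n hn => ⟨hs n hn.1, ht n hn.2⟩⟩
  | sUnion S _ ih =>
    obtain ⟨s, hs, hx⟩ := hx
    obtain ⟨N, hN, h⟩ := ih s hs hx
    exact ⟨N, hN, fun n hn => ⟨s, hs, h n hn⟩⟩

theorem isClosed_proamenableTopology_iff {G : Type*} [Group G] {H : Set G} :
    IsClosed[proamenableTopology G] H ↔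
      ∀ a ∉ H, ∃ N : Subgroup G, IsCoamenable N ∧ ∀ n ∈ N, a * n ∉ H := by
  rw [← @isOpen_compl_iff _ _ (proamenableTopology G)]
  refine ⟨fun h a ha => exists_isCoamenable_of_isOpen h ha, fun h => ?_⟩
  let := proamenableTopology G
  refine isOpen_iff_forall_mem_open.2 fun a ha => ?_
  obtain ⟨N, ⟨hN, hA⟩, hd⟩ := h a ha
  refine ⟨{x | a⁻¹ * x ∈ N}, fun x hx => ?_, .basic _ ⟨a, N, hN, hA, rfl⟩, ?_⟩
  · simpa using hd _ hx
  · simp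

theorem exists_isCoamenable_of_finite {G : Type*} [Group G] {H : Set G}
    (hH : IsClosed[proamenableTopology G] H) {T : Set G} (hT : T.Finite) (hd : ∀ a ∈ T, a ∉ H) :
    ∃ N : Subgroup G, IsCoamenable N ∧ ∀ a ∈ T, ∀ n ∈ N, a * n ∉ H := by
  induction T, hT using Set.Finite.induction_on with
  | empty => exact ⟨⊤, .top, by simp⟩
  | @insert a T _ _ ih =>
    obtain ⟨N, hN, h⟩ := ih fun b hb => hd b (.inr hb)
    obtain ⟨M, hM, h'⟩ := isClosed_proamenableTopology_iff.1 hH a (hd a (.inl rfl))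
    refine ⟨N ⊓ M, hN.inf hM, ?_⟩
    rintro b (rfl | hb) n hn
    · exact h' n hn.2
    · exact h b hb n hn.1

/-! ### Residual finiteness and actions on free groups -/

namespace FreeGroup

/-- Free groups are residually finite. -/
theorem exists_finite_lift_ne_one {α : Type u} {w : FreeGroup α} (hw : w ≠ 1) :
    ∃ (P : Type u) (_ : Group P) (_ : Finite P) (f : α → P), lift f w ≠ 1 := by
  classical
  -- The suffixes of `w` are the vertices of a path from `1` to `w` in the Cayley graph. Each
  -- generator acts as a partial injection of this finite set, which extends to a permutation.
  let T : Finset (FreeGroup α) := (w.toWord.tails.map mk).toFinset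
  have hT : ∀ {l}, l <:+ w.toWord → mk l ∈ T := fun h => by
    simpa [T] using ⟨_, h, rfl⟩
  have hext : ∀ x : α, ∃ e : T ≃ T, ∀ g : T, of x * g.1 ∈ T → (e g : FreeGroup α) = of x * g.1 :=
    fun x => by
      have := Set.MapsTo.exists_equiv_extend_of_card_eq (α := T) (t := T) (by simp)
        (s := {g : T | of x * g.1 ∈ T}) (f := fun g => of x * g.1) (fun g hg => hg)
        (fun g _ h _ he => Subtype.ext (mul_left_cancel he))
      exact this
  choose e he using hext
  refine ⟨Equiv.Perm T, inferInstance, inferInstance, e, fun h1 => hw ?_⟩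
  have h0 : mk [] ∈ T := hT (List.nil_suffix)
  have key : ∀ l (hl : l <:+ w.toWord), lift (β := Equiv.Perm T) e (mk l) ⟨mk [], h0⟩ =
      ⟨mk l, hT hl⟩ := by
    intro l
    induction l with
    | nil => exact fun _ => rfl
    | cons a l ih =>
      intro hl
      have hl' := (List.suffix_cons a l).trans hl
      have hmk : mk (a :: l) = mk [a] * mk l := by simp [mul_mk]
      obtain ⟨x, b⟩ := a
      have hmem := hT hl
      have hmk' : lift (β := Equiv.Perm T) e (mk ((x, b) :: l)) ⟨mk [], h0⟩ =
          lift (β := Equiv.Perm T) e (mk [(x, b)]) ⟨mk l, hT hl'⟩ := by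
        rw [hmk, _root_.map_mul, Equiv.Perm.mul_apply, ih hl']
      rw [hmk']
      cases b with
      | true =>
        have : lift (β := Equiv.Perm T) e (mk [(x, true)]) = e x := by simp
        rw [this]
        ext1
        rw [he]
        · exact hmk.symm
        · exact hmk ▸ hmem
      | false =>
        have : lift (β := Equiv.Perm T) e (mk [(x, false)]) = (e x : Equiv.Perm T)⁻¹ := by simp
        rw [this, Equiv.Perm.inv_eq_iff_eq]
        have hx : of x * mk ((x, false) :: l) = mk l := by
          rw [hmk, ← mul_assoc]
          change of x * (of x)⁻¹ * _ = _
          simp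
        ext1
        rw [he]
        · exact hx.symm
        · rw [hx]
          exact hT hl'
  have := congrArg Subtype.val (key _ List.suffix_rfl)
  simp only [mk_toWord, h1] at this
  exact this.symm

/-- A word involves only finitely many letters. -/
theorem exists_finite_lift_congr {α : Type*} (w : FreeGroup α) :
    ∃ S : Set α, S.Finite ∧ ∀ {P : Type*} [Group P] (f g : α → P), Set.EqOn f g S →
      lift f w = lift g w := by
  classical
  refine ⟨{x | x ∈ w.toWord.map Prod.fst}, List.finite_toSet _, fun f g h => ?_⟩
  rw [← mk_toWord (x := w), lift_mk, lift_mk]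
  refine congrArg List.prod (List.map_congr_left fun a ha => ?_)
  rw [h (List.mem_map_of_mem ha)]

/-- The action of `G` on `FreeGroup X` induced by an action on `X`. -/
def mapAut (G X : Type*) [Group G] [MulAction G X] : G →* MulAut (FreeGroup X) where
  toFun g := freeGroupCongr (MulAction.toPerm g)
  map_one' := by
    ext w
    change map _ _ = w
    simp [MulAction.toPerm_one]
  map_mul' g h := by
    ext w
    change map _ _ = map _ (map _ _)
    rw [map.comp]
    congr 2
    ext x
    exact mul_smul g h x

@[simp]
theorem mapAut_of {G X : Type*} [Group G] [MulAction G X] (g : G) (x : X) :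
    mapAut G X g (of x) = of (g • x) := by
  simp [mapAut]

end FreeGroup

/-- The action of `G` on `(X → P) → P` induced by an action on `X`. -/
def evalAut (G X P : Type*) [Group G] [MulAction G X] [Group P] :
    G →* MulAut ((X → P) → P) where
  toFun g :=
    { toFun F := fun f => F fun x => f (g • x)
      invFun F := fun f => F fun x => f (g⁻¹ • x)
      left_inv F := by ext; simp
      right_inv F := by ext; simp
      map_mul' _ _ := rfl }
  map_one' := by ext; simp
  map_mul' g h := by
    ext F f
    change F _ = F _
    simp only [mul_smul]

/-- The homomorphism from `FreeGroup X` to the product of copies of `P` indexed by the maps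
`f : X → P` whose components are the lifts of these `f`. -/
def FreeGroup.evalHom (X P : Type*) [Group P] : FreeGroup X →* ((X → P) → P) :=
  FreeGroup.lift fun x f => f x

theorem FreeGroup.evalHom_apply {X P : Type*} [Group P] (w : FreeGroup X) (f : X → P) :
    evalHom X P w f = lift f w := by
  have : (Pi.evalMonoidHom _ f).comp (evalHom X P) = lift f := by
    ext x
    simp [evalHom]
  exact DFunLike.congr_fun this w

theorem IsResiduallyAmenable.of_injective {B C : Type u} [Group B] [Group C] (i : B →* C)
    (hi : Function.Injective i) (hC : IsResiduallyAmenable C) : IsResiduallyAmenable B := by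
  intro b hb
  obtain ⟨D, _, φ, hD, -, hφ⟩ := hC (i b) ((map_ne_one_iff _ hi).2 hb)
  let ψ := φ.comp i
  exact ⟨ψ.range, inferInstance, ψ.rangeRestrict,
    hD.of_injective ψ.range.subtype Subtype.val_injective, ψ.rangeRestrict_surjective,
    fun h => hφ (congrArg Subtype.val h)⟩

/-! ### The semidirect product model and the two implications -/

namespace SpecialHNNExtension

variable {A : Type u} [Group A] (H : Subgroup A)

/-- The homomorphism from the special HNN extension to `FreeGroup (A ⧸ H) ⋊ A` that maps the stable
letter to the trivial coset. -/
def toSemidirect : SpecialHNNExtension A H →* FreeGroup (A ⧸ H) ⋊[FreeGroup.mapAut A (A ⧸ H)] A :=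
  HNNExtension.lift SemidirectProduct.inr (SemidirectProduct.inl (.of ((1 : A) : A ⧸ H))) fun h => by
    have hh : ((h : A) : A ⧸ H) = ((1 : A) : A ⧸ H) := QuotientGroup.eq.2 (by simp)
    ext <;> simp [hh]

/-- The conjugate `a t a⁻¹` of the stable letter, as a function of the coset `a H`. -/
def conjStable (x : A ⧸ H) : SpecialHNNExtension A H :=
  Quotient.liftOn' x (fun a => HNNExtension.of a * HNNExtension.t * (HNNExtension.of a)⁻¹)
    fun a b hab => by
      obtain ⟨k, rfl⟩ : ∃ k : H, b = a * k :=
        ⟨⟨a⁻¹ * b, QuotientGroup.leftRel_apply.1 hab⟩, by simp⟩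
      have h := HNNExtension.t_mul_of (φ := MulEquiv.refl H) k
      rw [MulEquiv.refl_apply] at h
      rw [map_mul, mul_inv_rev, mul_assoc (HNNExtension.of a) _ HNNExtension.t, ← h]
      simp [mul_assoc]

theorem conjStable_mk (a : A) : conjStable H (a : A ⧸ H) =
    HNNExtension.of a * HNNExtension.t * (HNNExtension.of a)⁻¹ :=
  rfl

/-- The inverse of `toSemidirect`, which maps the coset `a H` to `a t a⁻¹`. -/
def ofSemidirect : FreeGroup (A ⧸ H) ⋊[FreeGroup.mapAut A (A ⧸ H)] A →* SpecialHNNExtension A H :=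
  SemidirectProduct.lift (FreeGroup.lift (conjStable H)) HNNExtension.of fun a => by
    ext x
    induction x using QuotientGroup.induction_on with | _ b
    have hab : a • (b : A ⧸ H) = ((a * b : A) : A ⧸ H) := rfl
    simp [hab, conjStable_mk, mul_assoc]

theorem toSemidirect_injective : Function.Injective (toSemidirect H) := by
  have : (ofSemidirect H).comp (toSemidirect H) = MonoidHom.id _ := by
    refine HNNExtension.hom_ext ?_ ?_
    · ext a
      simp [toSemidirect, ofSemidirect]
    · simp [toSemidirect, ofSemidirect, conjStable_mk]
  exact Function.LeftInverse.injective (g := ofSemidirect H) fun x => DFunLike.congr_fun this x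

@[simp]
theorem toSemidirect_of (a : A) : toSemidirect H (HNNExtension.of a) = SemidirectProduct.inr a := by
  simp [toSemidirect]

@[simp]
theorem toSemidirect_t :
    toSemidirect H HNNExtension.t = SemidirectProduct.inl (.of ((1 : A) : A ⧸ H)) := by
  simp [toSemidirect]

theorem of_injective :
    Function.Injective (HNNExtension.of : A →* SpecialHNNExtension A H) :=
  HNNExtension.of_injective _

/-- The free components of the two sides are the generators `aH` and `H`. -/
theorem mem_of_commute {a : A}
    (h : (HNNExtension.of a : SpecialHNNExtension A H) * HNNExtension.t =
      HNNExtension.t * HNNExtension.of a) : a ∈ H := by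
  have := congrArg (fun g => (toSemidirect H g).left) h
  have h' : (a : A ⧸ H) = ((1 : A) : A ⧸ H) := by
    simpa [FreeGroup.of_injective.eq_iff] using this
  simpa using QuotientGroup.eq.1 h'

/-- The map `A ⧸ H → (A ⧸ N) ⧸ (H N / N)`. -/
def cosetMap (N : Subgroup A) [N.Normal] :
    A ⧸ H → (A ⧸ N) ⧸ H.map (QuotientGroup.mk' N) :=
  Quotient.map' (QuotientGroup.mk' N) fun a b hab => by
    rw [QuotientGroup.leftRel_apply] at hab ⊢
    exact ⟨_, hab, by simp⟩

/-- The homomorphism from `FreeGroup (A ⧸ H) ⋊ A` to a semidirect product of a power of `P`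
and `A ⧸ N`. -/
def toQuotient (N : Subgroup A) [N.Normal] (P : Type*) [Group P] :
    FreeGroup (A ⧸ H) ⋊[FreeGroup.mapAut A (A ⧸ H)] A →*
      (((A ⧸ N) ⧸ H.map (QuotientGroup.mk' N) → P) → P)
        ⋊[evalAut (A ⧸ N) ((A ⧸ N) ⧸ H.map (QuotientGroup.mk' N)) P] (A ⧸ N) :=
  SemidirectProduct.map ((FreeGroup.evalHom _ P).comp (FreeGroup.map (cosetMap H N)))
    (QuotientGroup.mk' N) fun a => by
      ext x f
      induction x using QuotientGroup.induction_on with | _ b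
      simp only [MonoidHom.comp_apply, MulEquiv.toMonoidHom_eq_coe, MonoidHom.coe_coe,
        FreeGroup.mapAut_of, FreeGroup.map.of, FreeGroup.evalHom]
      rfl

theorem cosetMap_injOn {N : Subgroup A} [N.Normal] {S : Set (A ⧸ H)}
    (h : ∀ x ∈ S, ∀ y ∈ S, x ≠ y → ∀ n ∈ N, x.out⁻¹ * y.out * n ∉ H) :
    Set.InjOn (cosetMap H N) S := by
  intro x hx y hy hxy
  by_contra hne
  rw [← QuotientGroup.out_eq' x, ← QuotientGroup.out_eq' y] at hxy
  obtain ⟨k, hk, hkN⟩ := QuotientGroup.leftRel_apply.1 (Quotient.exact' hxy)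
  have hkN' : ((k : A) : A ⧸ N) = ((x.out⁻¹ * y.out : A) : A ⧸ N) := hkN
  refine h x hx y hy hne _ (QuotientGroup.eq.1 hkN'.symm) ?_
  rwa [mul_inv_cancel_left]

theorem isResiduallyAmenable (hA : IsResiduallyAmenable A)
    (hH : IsClosed[proamenableTopology A] (H : Set A)) :
    IsResiduallyAmenable (SpecialHNNExtension A H) := by
  intro g hg
  have hg' : toSemidirect H g ≠ 1 := (map_ne_one_iff _ (toSemidirect_injective H)).2 hg
  suffices ∃ (C : Type u) (_ : Group C)
      (φ : FreeGroup (A ⧸ H) ⋊[FreeGroup.mapAut A (A ⧸ H)] A →* C),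
      IsAmenableGroup C ∧ φ (toSemidirect H g) ≠ 1 by
    obtain ⟨C, _, φ, hC, hφ⟩ := this
    let ψ := φ.comp (toSemidirect H)
    exact ⟨ψ.range, inferInstance, ψ.rangeRestrict,
      hC.of_injective ψ.range.subtype Subtype.val_injective, ψ.rangeRestrict_surjective,
      fun h => hφ (congrArg Subtype.val h)⟩
  generalize toSemidirect H g = x at hg'
  by_cases hr : x.right = 1
  · have hl : x.left ≠ 1 := fun hl => hg' (SemidirectProduct.ext hl hr)
    obtain ⟨P, _, _, f, hf⟩ := FreeGroup.exists_finite_lift_ne_one hl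
    obtain ⟨S, hS, hcongr⟩ := FreeGroup.exists_finite_lift_congr x.left
    obtain ⟨N, ⟨_, hN⟩, hsep⟩ := exists_isCoamenable_of_finite hH
      -- Two cosets are equal exactly when this quotient of representatives lies in `H`.
      (T := (fun p : (A ⧸ H) × (A ⧸ H) => p.1.out⁻¹ * p.2.out) '' ((S ×ˢ S) \ Set.diagonal _))
      ((hS.prod hS).sdiff.image _) (by
        rintro _ ⟨⟨y, z⟩, ⟨-, hne⟩, rfl⟩ hmem
        refine hne ?_
        have := QuotientGroup.eq.2 hmem
        simpa using this)
    have hinj : Set.InjOn (cosetMap H N) S := cosetMap_injOn H fun y hy z hz hne =>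
      hsep _ ⟨(y, z), ⟨⟨hy, hz⟩, hne⟩, rfl⟩
    refine ⟨_, _, toQuotient H N P, .semidirectProduct _ (.pi_const _ _) hN, fun h => hf ?_⟩
    classical
    have : Nonempty (A ⧸ H) := ⟨((1 : A) : A ⧸ H)⟩
    -- This coordinate pulls back along `cosetMap` to a map agreeing with `f` on `S`, so it sends
    -- `x.left` to the same value as `f`.
    have h1 := congrFun (congrArg SemidirectProduct.left h)
      (f ∘ Function.invFunOn (cosetMap H N) S)
    have h2 : FreeGroup.lift (f ∘ Function.invFunOn (cosetMap H N) S)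
        (FreeGroup.map (cosetMap H N) x.left) = 1 := by
      rw [← FreeGroup.evalHom_apply]
      exact h1
    rw [hcongr f ((f ∘ Function.invFunOn (cosetMap H N) S) ∘ cosetMap H N) fun y hy =>
      congrArg f (hinj.leftInvOn_invFunOn hy).symm, ← h2]
    have : FreeGroup.lift ((f ∘ Function.invFunOn (cosetMap H N) S) ∘ cosetMap H N) =
        (FreeGroup.lift (f ∘ Function.invFunOn (cosetMap H N) S)).comp
          (FreeGroup.map (cosetMap H N)) := by
      ext; simp
    rw [this, MonoidHom.comp_apply]
  · obtain ⟨C, _, φ, hC, -, hφ⟩ := hA _ hr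
    exact ⟨C, _, φ.comp SemidirectProduct.rightHom, hC, hφ⟩

theorem isClosed (h : IsResiduallyAmenable (SpecialHNNExtension A H)) :
    IsClosed[proamenableTopology A] (H : Set A) := by
  refine isClosed_proamenableTopology_iff.2 fun a ha => ?_
  let c : SpecialHNNExtension A H :=
    HNNExtension.of a * HNNExtension.t * (HNNExtension.t * HNNExtension.of a)⁻¹
  have hc : c ≠ 1 := fun h1 => ha (mem_of_commute H (mul_inv_eq_one.1 h1))
  obtain ⟨C, _, φ, hC, -, hφ⟩ := h c hc
  refine ⟨(φ.comp HNNExtension.of).ker, .ker hC _, fun n hn hmem => hφ ?_⟩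
  have hn' : φ (HNNExtension.of n) = 1 := hn
  -- If `a * n ∈ H` then `φ a = φ (a * n)` commutes with `φ t`, so `φ` kills `c`.
  have hcomm := congrArg φ (HNNExtension.t_mul_of (φ := MulEquiv.refl H) ⟨a * n, hmem⟩)
  simp only [MulEquiv.refl_apply, map_mul, hn', mul_one] at hcomm
  simp only [c, map_mul, map_inv, hcomm, mul_inv_cancel]

end SpecialHNNExtension

theorem corollary8 {A : Type*} [Group A] (H : Subgroup A) :
    IsResiduallyAmenable (SpecialHNNExtension A H) ↔
      IsResiduallyAmenable A ∧ IsClosed[proamenableTopology A] (H : Set A) :=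
  ⟨fun h => ⟨h.of_injective _ (SpecialHNNExtension.of_injective H),
    SpecialHNNExtension.isClosed H h⟩,
    fun h => SpecialHNNExtension.isResiduallyAmenable H h.1 h.2⟩
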